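/- **Theorem (Sobolev inequality for incoherent subspaces).** Let $d \ge 2$. There is a constant $C>0$, depending only on $d$, such that the following holds for all integers $n \ge 0$, $m\ge 0$, $s \ge 1$ with $N = 2^n$. Notation. $\mathbb{C}^{N^d}$ is the space of arrays $v=(v_\alpha)$, $\alpha\in\{0,\dots,N-1\}^d$, with $\|v\|_2^2=\sum_\alpha |v_\alpha|^2$. The discrete gradient is $(\nabla v)_{\alpha,\ell} = v_{\alpha+e_\ell}-v_\alpha$ if $\alpha_\ell< N-1$ and $0$ if $\alpha_\ell=N-1$, for $1\le \ell\le d$, and $$\|v\|_{TV_1}=\sum_{\alpha}\sum_{\ell=1}^d |(\nabla v)_{\alpha,\ell}|,\qquad \|v\|_{TV_2}=\sum_\alpha\Big(\sum_{\ell=1}^d |(\nabla v)_{\alpha,\ell}|^2\Big)^{1/2}.$$ Let $h^0=\mathbf 1_{[0,1)}$ and $h^1=\mathbf 1_{[0,1/2)}-\mathbf 1_{[1/2,1)}$. The discrete Haar transform $\mathcal H:\mathbb{C}^{N^d}\to\mathbb{C}^{N^d}$ is the unitary map that sends $v$ to its coefficients $\sum_\alpha v_\alpha h(\alpha)$ with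 respect to the orthonormal system consisting of the constant array $N^{-d/2}$ and the arrays $$h_{j,k,e}(\alpha)=N^{-d/2}\,2^{jd/2}\prod_{i=1}^d h^{e_i}\big(2^j\alpha_i/N-k_i\big),\qquad 0\le j\le n-1,\ k\in\{0,\dots,2^j-1\}^d,\ e\in\{0,1\}^d\setminus\{0\}.$$ A linear map $T:\mathbb{C}^{N^d}\to\mathbb{C}^m$ has the restricted isometry property (RIP) of order $r$ and level $\delta$ if $(1-\delta)\|x\|_2^2\le\|Tx\|_2^2\le(1+\delta)\|x\|_2^2$ for every $x$ with at most $r$ nonzero entries. Statement. Let $\mathcal A:\mathbb{C}^{N^d}\to\mathbb{C}^m$ be linear and suppose that $\mathcal A\mathcal H^*$ has the RIP of order $2s$ and level $\delta<1$. Then for every $\varepsilon$ and every $v\in\mathbb{C}^{N^d}$ with $\|\mathcal A v\|_2\le\varepsilon$, $$\|v\|_2\le \frac{1}{\sqrt{1-\delta}}\Big(C\,\frac{\|v\|_{TV_1}}{\sqrt s}\,\log(N^d)+\varepsilon\Big) \qquad\text{and}\qquad \|v\|_2\le \frac{1}{\sqrt{1-\delta}}\Big(C\,\frac{\|v\|_{TV_2}}{\sqrt{s/d}}\,\log(N^d)+\varepsilon\Big).$$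 -/

import Mathlib

noncomputable section

/-- `ℂ^{N^d}`: `d`-dimensional arrays of side length `N` with the entrywise `ℓ₂` norm.
The index set `{1, …, N}^d` is shifted to `{0, …, N - 1}^d`. -/
abbrev Signal (d N : ℕ) : Type := EuclideanSpace ℂ (Fin d → Fin N)

/-- The discrete gradient: `(∇x)_{α,ℓ} = x_{α + e_ℓ} - x_α`, and `0` when `α` lies on the last
layer in direction `ℓ`. -/
def discreteGradient {d N : ℕ} (x : Signal d N) (α : Fin d → Fin N) (l : Fin d) : ℂ :=
  if h : (α l : ℕ) + 1 < N then x (Function.update α l ⟨(α l : ℕ) + 1, h⟩) - x α else 0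

/-- The anisotropic total variation seminorm. -/
def anisotropicTV {d N : ℕ} (x : Signal d N) : ℝ :=
  ∑ α : Fin d → Fin N, ∑ l : Fin d, ‖discreteGradient x α l‖

/-- The isotropic total variation seminorm. -/
def isotropicTV {d N : ℕ} (x : Signal d N) : ℝ :=
  ∑ α : Fin d → Fin N, √(∑ l : Fin d, ‖discreteGradient x α l‖ ^ 2)

/-- The univariate functions `h⁰` (`false`) and `h¹` (`true`). -/
def haarUnivariate : Bool → ℝ → ℝ
  | false, t => if 0 ≤ t ∧ t < 1 then 1 else 0
  | true, t => if 0 ≤ t ∧ t < 1 / 2 then 1 else if 1 / 2 ≤ t ∧ t < 1 then -1 else 0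

/-- The continuous Haar function `h_{j,k}^e(u) = 2^{jd/2} h^e(2^j u - k)` on `ℝ^d`, where
`h^e(u) = ∏ i, h^{e_i}(u_i)`. -/
def haarFunction {d : ℕ} (j : ℕ) (k : Fin d → ℕ) (e : Fin d → Bool) (u : Fin d → ℝ) : ℝ :=
  (2 : ℝ) ^ ((j : ℝ) * (d : ℝ) / 2) *
    ∏ i : Fin d, haarUnivariate (e i) ((2 : ℝ) ^ j * u i - (k i : ℝ))

/-- Indices of the discrete Haar system for side length `2^n`: `none` is the constant function,
`some ⟨j, k, e⟩` is the wavelet of scale `0 ≤ j ≤ n - 1`, position `k ∈ {0, …, 2^j - 1}^d` and type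
`e ∈ {0,1}^d`, `e ≠ 0`. -/
abbrev HaarIndex (d n : ℕ) : Type :=
  Option (Σ j : Fin n, (Fin d → Fin (2 ^ (j : ℕ))) × {e : Fin d → Bool // e ≠ fun _ => false})

/-- The discrete Haar system: the samples `N^{-d/2} h(α / N)`, `α ∈ {0, …, N - 1}^d`, of the
continuous one, `N = 2^n`. -/
def haarVector (d n : ℕ) : HaarIndex d n → Signal d (2 ^ n)
  | none => WithLp.toLp 2 fun _ => (((2 ^ n : ℝ) ^ (-(d : ℝ) / 2) : ℝ) : ℂ)
  | some ⟨j, k, e⟩ => WithLp.toLp 2 fun α =>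
      (((2 ^ n : ℝ) ^ (-(d : ℝ) / 2) *
        haarFunction (j : ℕ) (fun i => (k i : ℕ)) e.1
          (fun i => ((α i : ℕ) : ℝ) / (2 ^ n : ℝ)) : ℝ) : ℂ)

/-- The discrete Haar transform, sending `x` to its coefficients against the (real) Haar
vectors. -/
def haarTransform (d n : ℕ) : Signal d (2 ^ n) →ₗ[ℂ] EuclideanSpace ℂ (HaarIndex d n) where
  toFun x := WithLp.toLp 2 fun t => inner ℂ (haarVector d n t) x
  map_add' x y := by
    ext t
    simp only [inner_add_right, PiLp.add_apply]
  map_smul' c x := by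
    ext t
    simp only [inner_smul_right, PiLp.smul_apply, smul_eq_mul, RingHom.id_apply]

/-- `x` has at most `s` nonzero entries. -/
def IsSparse {ι : Type*} [Fintype ι] (s : ℕ) (x : EuclideanSpace ℂ ι) : Prop :=
  {t : ι | x t ≠ 0}.ncard ≤ s

/-- The restricted isometry property of order `s` and level `δ`. -/
def HasRIP {ι κ : Type*} [Fintype ι] [Fintype κ]
    (T : EuclideanSpace ℂ ι →ₗ[ℂ] EuclideanSpace ℂ κ) (s : ℕ) (δ : ℝ) : Prop :=
  ∀ x : EuclideanSpace ℂ ι, IsSparse s x →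
    (1 - δ) * ‖x‖ ^ 2 ≤ ‖T x‖ ^ 2 ∧ ‖T x‖ ^ 2 ≤ (1 + δ) * ‖x‖ ^ 2

end

/-! The argument combines an `ℓ₁` bound on the Haar coefficients with a compressed-sensing estimate.

Fix a scale and a type `e ≠ 0`, and choose a direction in which the wavelet oscillates. There each
coefficient is a weighted sum of differences between two half-blocks of length `M`. Telescoping
bounds these by `M` times the variation, and the supports at one scale are disjoint, so the
normalization `(2M)^(-d/2)` times `M` is at most 1 when `d ≥ 2`. Each of the `n` scales and fewer
than `2^d` types thus costs at most one total variation (`sum_norm_haarTransform_le`). This gives an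
`ℓ₁` bound with factor `n * 2^d`, and `n ≤ log (N^d)`.

The constant coefficient is invisible to the total variation. `HasRIP.norm_le` therefore puts it in
the head together with the `s` largest others, at most `2s` entries in all, and splits the tail into
blocks of size `s`. The two estimates are joined by `H* H = 1`, which follows by telescoping
projection kernels over the scales. -/

open Finset

/-! ### Coordinate restrictions and blocks of large entries. -/

/-- The restriction of `x` to the coordinates in `F`. -/
noncomputable def coordRestrict {ι : Type*} [DecidableEq ι] (F : Finset ι)
    (x : EuclideanSpace ℂ ι) : EuclideanSpace ℂ ι :=
  WithLp.toLp 2 fun t => if t ∈ F then x t else 0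

section Restriction

variable {ι : Type*} [DecidableEq ι]

lemma coordRestrict_apply (F : Finset ι) (x : EuclideanSpace ℂ ι) (t : ι) :
    coordRestrict F x t = if t ∈ F then x t else 0 := rfl

lemma coordRestrict_add_sdiff {F G : Finset ι} (h : G ⊆ F) (x : EuclideanSpace ℂ ι) :
    coordRestrict G x + coordRestrict (F \ G) x = coordRestrict F x := by
  ext t
  simp only [PiLp.add_apply, coordRestrict_apply, mem_sdiff]
  by_cases h1 : t ∈ G
  · simp [h1, h h1]
  · simp [h1]

variable [Fintype ι]

lemma coordRestrict_univ (x : EuclideanSpace ℂ ι) : coordRestrict univ x = x := by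
  ext t
  simp [coordRestrict_apply]

lemma isSparse_coordRestrict (F : Finset ι) (x : EuclideanSpace ℂ ι) {s : ℕ} (h : #F ≤ s) :
    IsSparse s (coordRestrict F x) := by
  refine le_trans ?_ h
  rw [← Set.ncard_coe_finset F]
  refine Set.ncard_le_ncard (fun t ht => ?_) F.finite_toSet
  by_contra h1
  exact ht (by rw [coordRestrict_apply, if_neg (by simpa using h1)])

lemma norm_coordRestrict_le (F : Finset ι) (x : EuclideanSpace ℂ ι) {s : ℕ} (h : #F ≤ s)
    {b : ℝ} (hb0 : 0 ≤ b) (hb : ∀ t ∈ F, ‖x t‖ ≤ b) :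
    ‖coordRestrict F x‖ ≤ √(s : ℝ) * b := by
  rw [EuclideanSpace.norm_eq]
  refine Real.sqrt_le_iff.2 ⟨by positivity, ?_⟩
  rw [mul_pow, Real.sq_sqrt (by positivity)]
  calc ∑ t, ‖coordRestrict F x t‖ ^ 2 = ∑ t ∈ F, ‖x t‖ ^ 2 := by
        rw [← Finset.sum_filter_add_sum_filter_not univ (· ∈ F)]
        rw [Finset.sum_eq_zero (s := univ.filter (¬ · ∈ F)), add_zero]
        · refine Finset.sum_congr (by ext; simp) fun t ht => by
            simp [coordRestrict_apply, ht]
        · intro t ht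
          simp [coordRestrict_apply, (mem_filter.1 ht).2]
    _ ≤ ∑ t ∈ F, b ^ 2 := Finset.sum_le_sum fun t ht => by
        have := hb t ht
        gcongr
    _ = #F * b ^ 2 := by simp
    _ ≤ s * b ^ 2 := by gcongr

end Restriction

/-- A finite set contains `s` elements at which `f` is largest. -/
lemma exists_subset_card_eq_largest {ι : Type*} [DecidableEq ι] (f : ι → ℝ) (F : Finset ι)
    (s : ℕ) (h : s ≤ #F) :
    ∃ G ⊆ F, #G = s ∧ ∀ t ∈ F \ G, ∀ g ∈ G, f t ≤ f g := by
  induction s with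
  | zero => exact ⟨∅, by simp⟩
  | succ s ih =>
    obtain ⟨G, hGF, hG, hmax⟩ := ih (by omega)
    have hne : (F \ G).Nonempty := by
      rw [← Finset.card_pos, Finset.card_sdiff_of_subset hGF]
      omega
    obtain ⟨a, ha, hamax⟩ := Finset.exists_max_image (F \ G) f hne
    have ha' := mem_sdiff.1 ha
    refine ⟨insert a G, ?_, ?_, ?_⟩
    · intro t ht
      rcases mem_insert.1 ht with rfl | ht
      exacts [ha'.1, hGF ht]
    · rw [card_insert_of_notMem ha'.2, hG]
    · intro t ht g hg
      have ht' : t ∈ F \ G := by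
        simp only [mem_sdiff, mem_insert, not_or] at ht ⊢
        exact ⟨ht.1, ht.2.2⟩
      rcases mem_insert.1 hg with rfl | hg
      exacts [hamax t ht', hmax t ht' g hg]

/-- A set with at least `s` elements contains `s` elements whose average of `f` dominates `f` on
the remaining ones. -/
lemma exists_subset_card_eq_le_average {ι : Type*} [DecidableEq ι] (f : ι → ℝ) (F : Finset ι)
    {s : ℕ} (hs : 1 ≤ s) (h : s ≤ #F) :
    ∃ G ⊆ F, #G = s ∧ ∀ t ∈ F \ G, f t ≤ (∑ g ∈ G, f g) / s := by
  obtain ⟨G, hGF, hG, hmax⟩ := exists_subset_card_eq_largest f F s h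
  refine ⟨G, hGF, hG, fun t ht => ?_⟩
  have hs' : (0 : ℝ) < s := by exact_mod_cast hs
  rw [le_div_iff₀ hs', mul_comm, ← hG, ← nsmul_eq_mul]
  exact Finset.card_nsmul_le_sum _ _ _ (hmax t ht)

lemma sqrt_mul_div_self (s : ℕ) (a : ℝ) : √(s : ℝ) * (a / s) = a / √(s : ℝ) := by
  rcases Nat.eq_zero_or_pos s with rfl | hs
  · simp
  have hs' : (0 : ℝ) < s := by exact_mod_cast hs
  have h := Real.sq_sqrt hs'.le
  have h2 := (Real.sqrt_pos.2 hs').ne'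
  field_simp
  rw [h, mul_comm]

/-- A seminorm controlled by the Euclidean norm on `s`-sparse vectors is controlled by the `ℓ_∞`
and `ℓ₁` norms on all vectors. -/
lemma seminorm_coordRestrict_le {ι : Type*} [DecidableEq ι] [Fintype ι]
    (p : Seminorm ℂ (EuclideanSpace ℂ ι)) {K : ℝ} (hK : 0 ≤ K) {s : ℕ} (hs : 1 ≤ s)
    (hp : ∀ x, IsSparse s x → p x ≤ K * ‖x‖) (x : EuclideanSpace ℂ ι) (F : Finset ι) :
    ∀ b : ℝ, 0 ≤ b → (∀ t ∈ F, ‖x t‖ ≤ b) →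
      p (coordRestrict F x) ≤ K * (√(s : ℝ) * b + (∑ t ∈ F, ‖x t‖) / √(s : ℝ)) := by
  induction F using Finset.strongInduction with
  | H F ih =>
    intro b hb0 hb
    by_cases hF : #F ≤ s
    · calc p (coordRestrict F x) ≤ K * ‖coordRestrict F x‖ :=
            hp _ (isSparse_coordRestrict F x hF)
        _ ≤ K * (√(s : ℝ) * b + (∑ t ∈ F, ‖x t‖) / √(s : ℝ)) := by
            have h1 := norm_coordRestrict_le F x hF hb0 hb
            have h2 : 0 ≤ (∑ t ∈ F, ‖x t‖) / √(s : ℝ) := by positivity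
            gcongr
            linarith
    -- Peel off the `s` largest entries. Their average is the new sup bound on the rest, and `√s`
    -- times that average is `(∑ over G) / √s`, which is exactly the share of `G` in the `ℓ₁` term.
    · obtain ⟨G, hGF, hG, havg⟩ :=
        exists_subset_card_eq_le_average (fun t => ‖x t‖) F hs (by omega)
      have hlt : F \ G ⊂ F := by
        refine Finset.sdiff_ssubset hGF ?_
        rw [← Finset.card_pos]
        omega
      have h1 := ih _ hlt _ (by positivity) havg
      rw [sqrt_mul_div_self] at h1
      have h2 : p (coordRestrict G x) ≤ K * (√(s : ℝ) * b) :=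
        (hp _ (isSparse_coordRestrict G x hG.le)).trans <| by
          have := norm_coordRestrict_le G x hG.le hb0 fun t ht => hb t (hGF ht)
          gcongr
      rw [← coordRestrict_add_sdiff hGF x, ← Finset.sum_sdiff hGF]
      refine (map_add_le_add p _ _).trans ((add_le_add h2 h1).trans (le_of_eq ?_))
      ring

/-! ### Stability from the restricted isometry property. -/

/-- Under the restricted isometry property, a vector is controlled by its image and by the `ℓ₁`
norm of all its coordinates but one. -/
lemma HasRIP.norm_le {ι κ : Type*} [DecidableEq ι] [Fintype ι] [Fintype κ]
    {T : EuclideanSpace ℂ ι →ₗ[ℂ] EuclideanSpace ℂ κ} {s : ℕ} (hs : 1 ≤ s) {δ : ℝ} (hδ : δ < 1)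
    (hT : HasRIP T (2 * s) δ) (i₀ : ι) (x : EuclideanSpace ℂ ι) {ε B : ℝ} (hε : ‖T x‖ ≤ ε)
    (hB : ∑ t ∈ univ.erase i₀, ‖x t‖ ≤ B) :
    ‖x‖ ≤ (6 * (B / √(s : ℝ)) + ε) / √(1 - δ) := by
  -- Testing on one unit vector gives `1 - δ ≤ 1 + δ`.
  have hδ0 : 0 ≤ δ := by
    have h := hT (EuclideanSpace.single i₀ 1) (by
      refine le_trans (Set.ncard_le_ncard (t := {i₀}) fun t ht => ?_) ?_
      · by_contra h
        exact ht (by simpa using h)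
      · simp; omega)
    simp only [PiLp.norm_single, norm_one] at h
    linarith [h.1, h.2]
  set K := √(1 + δ) with hKdef
  have hK2 : K ≤ 2 := by
    rw [hKdef, Real.sqrt_le_left (by norm_num)]
    linarith
  have hK0 : 0 ≤ K := Real.sqrt_nonneg _
  set q := √(1 - δ) with hqdef
  have hq0 : 0 < q := Real.sqrt_pos.2 (by linarith)
  have hq1 : q ≤ 1 := by
    rw [hqdef, Real.sqrt_le_left (by norm_num)]
    linarith
  have hup : ∀ y, IsSparse (2 * s) y → ‖T y‖ ≤ K * ‖y‖ := fun y hy => by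
    refine le_of_sq_le_sq ?_ (by positivity)
    rw [mul_pow, hKdef, Real.sq_sqrt (by linarith)]
    exact (hT y hy).2
  have hlow : ∀ y, IsSparse (2 * s) y → q * ‖y‖ ≤ ‖T y‖ := fun y hy => by
    refine le_of_sq_le_sq ?_ (by positivity)
    rw [mul_pow, hqdef, Real.sq_sqrt (by linarith)]
    exact (hT y hy).1
  have hsum0 : 0 ≤ ∑ t ∈ univ.erase i₀, ‖x t‖ := by positivity
  -- The head `H` has at most `s + 1 ≤ 2 * s` entries. The tail bound is stated for every seminorm
  -- because it is needed both for the norm and for the norm after `T`.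
  obtain ⟨H, hH, htail⟩ : ∃ H : Finset ι, #H ≤ 2 * s ∧
      ∀ (p : Seminorm ℂ (EuclideanSpace ℂ ι)) (K : ℝ), 0 ≤ K →
        (∀ x, IsSparse s x → p x ≤ K * ‖x‖) →
        p (coordRestrict (univ \ H) x) ≤ K * (2 * (B / √(s : ℝ))) := by
    by_cases hc : #(univ.erase i₀) ≤ s
    · refine ⟨univ, ?_, fun p K hK _ => ?_⟩
      · rw [Finset.card_erase_of_mem (mem_univ _)] at hc
        omega
      · have : coordRestrict (univ \ univ) x = 0 := by
          ext t
          simp [coordRestrict_apply]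
        rw [this, map_zero]
        have := hsum0.trans hB
        positivity
    · obtain ⟨G, hGF, hG, havg⟩ :=
        exists_subset_card_eq_le_average (fun t => ‖x t‖) (univ.erase i₀) hs (by omega)
      have heq : univ \ insert i₀ G = univ.erase i₀ \ G := by
        ext t
        simp
      refine ⟨insert i₀ G, (card_insert_le _ _).trans (by omega), fun p K hK hp => ?_⟩
      rw [heq]
      refine (seminorm_coordRestrict_le p hK hs hp x _ _ (by positivity) havg).trans ?_
      rw [sqrt_mul_div_self, two_mul]
      have h1 : ∑ t ∈ G, ‖x t‖ ≤ B :=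
        (Finset.sum_le_sum_of_subset_of_nonneg hGF fun _ _ _ => norm_nonneg _).trans hB
      have h2 : ∑ t ∈ univ.erase i₀ \ G, ‖x t‖ ≤ B :=
        (Finset.sum_le_sum_of_subset_of_nonneg sdiff_subset fun _ _ _ => norm_nonneg _).trans hB
      gcongr
  have hsplit := coordRestrict_add_sdiff (subset_univ H) x
  rw [coordRestrict_univ] at hsplit
  set y := coordRestrict H x
  set z := coordRestrict (univ \ H) x
  have hz1 : ‖z‖ ≤ 1 * (2 * (B / √(s : ℝ))) :=
    htail (normSeminorm ℂ _) 1 zero_le_one fun x _ => by simp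
  have hz2 : ‖T z‖ ≤ K * (2 * (B / √(s : ℝ))) :=
    htail ((normSeminorm ℂ _).comp T) K hK0 fun x hx =>
      hup x (le_trans hx (by omega))
  have hy : q * ‖y‖ ≤ ‖T y‖ := hlow y (isSparse_coordRestrict H x hH)
  have hTy : ‖T y‖ ≤ ‖T x‖ + ‖T z‖ := by
    have : T y = T x - T z := by rw [← hsplit, map_add, add_sub_cancel_right]
    rw [this]
    exact norm_sub_le _ _
  have hx : ‖x‖ ≤ ‖y‖ + ‖z‖ := by
    rw [← hsplit]
    exact norm_add_le _ _
  have hBs : 0 ≤ B / √(s : ℝ) := div_nonneg (hsum0.trans hB) (Real.sqrt_nonneg _)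
  rw [le_div_iff₀ hq0]
  have h3 : K * (2 * (B / √(s : ℝ))) ≤ 2 * (2 * (B / √(s : ℝ))) := by gcongr
  have h4 : ‖z‖ * q ≤ ‖z‖ * 1 := by gcongr
  have h5 : ‖x‖ * q ≤ (‖y‖ + ‖z‖) * q := by gcongr
  -- The constant 6 is 4 from `‖T z‖`, where `K ≤ 2`, plus 2 from `‖z‖`.
  linarith

/-! ### Univariate Haar functions on the integers. -/

/-- The univariate Haar functions on the naturals: type `e`, position `κ`, blocks of length
`2 * M`. -/
noncomputable def dyadicHaar (M : ℕ) (e : Bool) (κ a : ℕ) : ℝ :=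
  if a / M / 2 = κ then (if e = true ∧ a / M % 2 = 1 then -1 else 1) else 0

lemma haarUnivariate_eq_dyadicHaar {M : ℕ} (hM : 0 < M) (e : Bool) (κ a : ℕ) :
    haarUnivariate e ((a : ℝ) / (2 * M) - κ) = dyadicHaar M e κ a := by
  have hM' : (0 : ℝ) < 2 * M := by positivity
  have e1 : 0 ≤ (a : ℝ) / (2 * M) - κ ↔ 2 * κ ≤ a / M := by
    rw [sub_nonneg, le_div_iff₀ hM', Nat.le_div_iff_mul_le hM]
    norm_cast
    rw [show κ * (2 * M) = 2 * κ * M by ring]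
  have e2 : (a : ℝ) / (2 * M) - κ < 1 ↔ a / M < 2 * κ + 2 := by
    rw [sub_lt_iff_lt_add, div_lt_iff₀ hM', Nat.div_lt_iff_lt_mul hM]
    norm_cast
    rw [show (1 + κ) * (2 * M) = (2 * κ + 2) * M by ring]
  have e3 : (a : ℝ) / (2 * M) - κ < 1 / 2 ↔ a / M < 2 * κ + 1 := by
    rw [sub_lt_iff_lt_add, div_lt_iff₀ hM', Nat.div_lt_iff_lt_mul hM,
      show (1 / 2 + (κ : ℝ)) * (2 * M) = ((2 * κ + 1) * M : ℕ) by push_cast; ring]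
    norm_cast
  have e4 : 1 / 2 ≤ (a : ℝ) / (2 * M) - κ ↔ 2 * κ + 1 ≤ a / M := by
    rw [← not_lt, e3, not_lt]
  cases e
  · simp only [haarUnivariate, dyadicHaar, e1, e2]
    simp only [Bool.false_eq_true, false_and, if_false]
    congr 1
    exact propext (by omega)
  · simp only [haarUnivariate, dyadicHaar, e1, e2, e3, e4, true_and]
    split_ifs <;> first | rfl | omega

lemma abs_dyadicHaar (M : ℕ) (e : Bool) (κ a : ℕ) :
    |dyadicHaar M e κ a| = if a / M / 2 = κ then 1 else 0 := by
  unfold dyadicHaar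
  split_ifs <;> simp

lemma sum_abs_dyadicHaar_le (M K : ℕ) (e : Bool) (a : ℕ) :
    ∑ κ : Fin K, |dyadicHaar M e κ a| ≤ 1 := by
  simp only [abs_dyadicHaar]
  rw [Fin.sum_univ_eq_sum_range (fun κ => if a / M / 2 = κ then (1 : ℝ) else 0),
    Finset.sum_ite_eq]
  split_ifs <;> norm_num

lemma sum_dyadicHaar_false_mul {M K a : ℕ} (ha : a / M / 2 < K) (b : ℕ) :
    ∑ κ : Fin K, dyadicHaar M false κ a * dyadicHaar M false κ b =
      if a / (2 * M) = b / (2 * M) then 1 else 0 := by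
  rw [Fin.sum_univ_eq_sum_range
    (fun κ => dyadicHaar M false κ a * dyadicHaar M false κ b) K]
  simp only [dyadicHaar, ite_mul, zero_mul]
  rw [Finset.sum_ite_eq, if_pos (mem_range.2 ha)]
  simp only [mul_comm 2 M, ← Nat.div_div_eq_div_mul]
  simp [eq_comm]

/-- Within one block of length `2 * M`, the two types add up to 2 on equal halves and cancel on
opposite halves. Adding type `true` thus refines blocks of length `2 * M` to length `M`. -/
lemma sum_dyadicHaar_mul {M K a : ℕ} (ha : a / M / 2 < K) (b : ℕ) :
    ∑ κ : Fin K, ∑ e : Bool, dyadicHaar M e κ a * dyadicHaar M e κ b =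
      2 * if a / M = b / M then 1 else 0 := by
  rw [Fin.sum_univ_eq_sum_range
    (fun κ => ∑ e : Bool, dyadicHaar M e κ a * dyadicHaar M e κ b) K]
  rw [Finset.sum_eq_single_of_mem _ (mem_range.2 ha)]
  · simp only [Fintype.sum_bool, dyadicHaar]
    simp only [if_true, true_and, Bool.false_eq_true, false_and, if_false]
    split_ifs <;> first | omega | norm_num
  · intro κ _ hκ
    simp [dyadicHaar, hκ.symm]

lemma sum_range_mul_eq_sum_Ico (D : ℕ → ℝ) (L K : ℕ) :
    ∑ κ ∈ range K, ∑ t ∈ Ico (L * κ) (L * κ + L), D t = ∑ t ∈ range (L * K), D t := by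
  induction K with
  | zero => simp
  | succ K ih =>
    rw [Finset.sum_range_succ, ih, Finset.range_eq_Ico, Finset.range_eq_Ico,
      Finset.sum_Ico_consecutive _ (Nat.zero_le _) (Nat.le_add_right _ _), mul_add, mul_one]

lemma sum_dyadicHaar_true_smul {M : ℕ} (hM : 0 < M) {K κ : ℕ} (hκ : κ < K) (g : ℕ → ℂ) :
    ∑ a ∈ range (2 * M * K), (dyadicHaar M true κ a : ℂ) * g a =
      ∑ r ∈ range M, (g (2 * M * κ + r) - g (2 * M * κ + (M + r))) := by
  have hsub : Ico (2 * M * κ) (2 * M * κ + 2 * M) ⊆ range (2 * M * K) := by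
    intro a ha
    rw [mem_Ico] at ha
    rw [mem_range]
    nlinarith [ha.2, Nat.mul_le_mul_left (2 * M) hκ]
  rw [← Finset.sum_subset hsub]
  · rw [Finset.sum_Ico_eq_sum_range, Nat.add_sub_cancel_left, two_mul, Finset.sum_range_add,
      ← Finset.sum_add_distrib]
    refine Finset.sum_congr rfl fun r hr => ?_
    have hr := mem_range.1 hr
    have h1 : ((M + M) * κ + r) / M = 2 * κ := by
      rw [show (M + M) * κ + r = r + M * (2 * κ) by ring, Nat.add_mul_div_left _ _ hM,
        Nat.div_eq_of_lt hr, zero_add]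
    have h2 : ((M + M) * κ + (M + r)) / M = 2 * κ + 1 := by
      rw [show (M + M) * κ + (M + r) = r + M * (2 * κ + 1) by ring, Nat.add_mul_div_left _ _ hM,
        Nat.div_eq_of_lt hr, zero_add]
    have h3 : (2 * κ + 1) / 2 = κ := by omega
    have h4 : 2 * κ % 2 = 0 := by omega
    have h5 : (2 * κ + 1) % 2 = 1 := by omega
    simp [dyadicHaar, h1, h2, h3, h4, h5, sub_eq_add_neg]
  · intro a _ ha
    rw [dyadicHaar, if_neg, Complex.ofReal_zero, zero_mul]
    rintro rfl
    apply ha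
    rw [Nat.div_div_eq_div_mul, mul_comm M 2, mem_Ico]
    have := Nat.div_add_mod a (2 * M)
    have := Nat.mod_lt a (show 0 < 2 * M by omega)
    omega

/-- The `ℓ₁` norm of the univariate Haar coefficients at one scale is bounded by the variation. -/
lemma sum_norm_dyadicHaar_le {M : ℕ} (hM : 0 < M) (K : ℕ) (g : ℕ → ℂ) :
    ∑ κ : Fin K, ‖∑ a ∈ range (2 * M * K), (dyadicHaar M true κ a : ℂ) * g a‖ ≤
      M * ∑ a ∈ range (2 * M * K), ‖g (a + 1) - g a‖ := by
  rw [Fin.sum_univ_eq_sum_range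
    (fun κ => ‖∑ a ∈ range (2 * M * K), (dyadicHaar M true κ a : ℂ) * g a‖) K,
    ← sum_range_mul_eq_sum_Ico, Finset.mul_sum]
  refine Finset.sum_le_sum fun κ hκ => ?_
  rw [sum_dyadicHaar_true_smul hM (mem_range.1 hκ)]
  refine (norm_sum_le _ _).trans ?_
  -- Each of the `M` differences telescopes along a path inside the block, so it is at most the
  -- variation over the whole block.
  calc ∑ r ∈ range M, ‖g (2 * M * κ + r) - g (2 * M * κ + (M + r))‖
      ≤ ∑ r ∈ range M, ∑ t ∈ Ico (2 * M * κ) (2 * M * κ + 2 * M), ‖g (t + 1) - g t‖ := by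
        refine Finset.sum_le_sum fun r hr => ?_
        have hr := mem_range.1 hr
        rw [← dist_eq_norm]
        refine (dist_le_Ico_sum_dist g (by omega)).trans ?_
        simp only [dist_comm (g _) (g (_ + 1)), dist_eq_norm]
        refine Finset.sum_le_sum_of_subset_of_nonneg (fun t ht => ?_) fun _ _ _ => norm_nonneg _
        rw [mem_Ico] at ht ⊢
        omega
    _ = M * ∑ t ∈ Ico (2 * M * κ) (2 * M * κ + 2 * M), ‖g (t + 1) - g t‖ := by simp

/-! ### The discrete Haar transform is an isometry. -/

/-- The real entries of the discrete Haar system. -/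
noncomputable def haarEntry (d n : ℕ) : HaarIndex d n → (Fin d → Fin (2 ^ n)) → ℝ
  | none, _ => (2 ^ n : ℝ) ^ (-(d : ℝ) / 2)
  | some ⟨j, k, e⟩, α => (2 * 2 ^ (n - 1 - (j : ℕ)) : ℝ) ^ (-(d : ℝ) / 2) *
      ∏ i, dyadicHaar (2 ^ (n - 1 - (j : ℕ))) (e.1 i) (k i) (α i)

lemma two_pow_eq_scale {n j : ℕ} (hj : j < n) : 2 ^ n = 2 * 2 ^ (n - 1 - j) * 2 ^ j := by
  rw [← pow_succ', ← pow_add]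
  congr 1
  omega

lemma two_pow_eq_scale_real {n j : ℕ} (hj : j < n) :
    (2 : ℝ) ^ n = 2 * 2 ^ (n - 1 - j) * 2 ^ j := by
  exact_mod_cast two_pow_eq_scale hj

lemma haarVector_apply {d n : ℕ} (t : HaarIndex d n) (α : Fin d → Fin (2 ^ n)) :
    haarVector d n t α = (haarEntry d n t α : ℂ) := by
  rcases t with _ | ⟨j, k, e⟩
  · rfl
  · simp only [haarVector, haarEntry, haarFunction]
    have hN := two_pow_eq_scale_real j.2
    set M : ℕ := 2 ^ (n - 1 - (j : ℕ)) with hM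
    have hMr : (2 : ℝ) ^ (n - 1 - (j : ℕ)) = M := by rw [hM]; push_cast; rfl
    have hM0 : 0 < M := by positivity
    have hM0' : (0 : ℝ) < M := by exact_mod_cast hM0
    rw [hMr] at hN ⊢
    rw [hN, Real.mul_rpow (by positivity) (by positivity)]
    -- Since `N = 2 * M * 2^j`, the factor `2^(jd/2)` cancels against part of `N^(-d/2)` and leaves
    -- `(2M)^(-d/2)`.
    have h1 : ((2 : ℝ) ^ (j : ℕ)) ^ (-(d : ℝ) / 2) * (2 : ℝ) ^ ((j : ℕ) * (d : ℝ) / 2) = 1 := by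
      rw [← Real.rpow_natCast, ← Real.rpow_mul (by norm_num), ← Real.rpow_add (by norm_num)]
      ring_nf
      simp
    have h2 : ∀ i, haarUnivariate (e.1 i)
        (2 ^ (j : ℕ) * (((α i : ℕ) : ℝ) / (2 * M * 2 ^ (j : ℕ))) - (k i : ℕ)) =
          dyadicHaar M (e.1 i) (k i) (α i) := by
      intro i
      rw [← haarUnivariate_eq_dyadicHaar hM0]
      congr 2
      field_simp
    simp only [h2]
    congr 1
    linear_combination ((2 * M : ℝ) ^ (-(d : ℝ) / 2) *
      ∏ i, dyadicHaar M (e.1 i) (k i) (α i)) * h1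

lemma haarTransform_apply {d n : ℕ} (x : Signal d (2 ^ n)) (t : HaarIndex d n) :
    haarTransform d n x t = ∑ α, (haarEntry d n t α : ℂ) * x α := by
  change inner ℂ (haarVector d n t) x = _
  rw [PiLp.inner_apply]
  refine Finset.sum_congr rfl fun α _ => ?_
  rw [haarVector_apply, RCLike.inner_apply, mul_comm]
  simp

lemma sum_sum_prod_eq_prod_sum_sum {ι A B : Type*} [Fintype ι] [DecidableEq ι] [Fintype A]
    [Fintype B] (f : ι → A → B → ℝ) :
    ∑ k : ι → A, ∑ e : ι → B, ∏ i, f i (k i) (e i) = ∏ i, ∑ κ, ∑ b, f i κ b := by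
  simp only [Finset.prod_univ_sum, Fintype.piFinset_univ]

lemma two_pow_scale_div_lt {n j : ℕ} (hj : j < n) (a : Fin (2 ^ n)) :
    (a : ℕ) / 2 ^ (n - 1 - j) / 2 < 2 ^ j := by
  rw [Nat.div_div_eq_div_mul, Nat.div_lt_iff_lt_mul (by positivity)]
  have h1 := a.2
  have h2 := two_pow_eq_scale hj
  linarith

/-- The kernel of the orthogonal projection onto the signals that are constant on the dyadic cubes
of scale `l`. -/
noncomputable def dyadicKernel {d n : ℕ} (α β : Fin d → Fin (2 ^ n)) (l : ℕ) : ℝ :=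
  ((2 : ℝ) ^ l / 2 ^ n) ^ d *
    ∏ i, if (α i : ℕ) / 2 ^ (n - l) = (β i : ℕ) / 2 ^ (n - l) then 1 else 0

/-- Summed over all types, the products factor over coordinates and give the kernel of the finer
scale. The excluded type `e = 0` accounts for the kernel of the coarser one. -/
lemma sum_haarEntry_mul_scale {d n : ℕ} (α β : Fin d → Fin (2 ^ n)) (j : Fin n) :
    ∑ k, ∑ e, haarEntry d n (some ⟨j, k, e⟩) α * haarEntry d n (some ⟨j, k, e⟩) β =
      dyadicKernel α β (j + 1) - dyadicKernel α β j := by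
  simp only [haarEntry]
  have hN := two_pow_eq_scale_real j.2
  have hlt := fun a => two_pow_scale_div_lt j.2 a
  have hexp : 2 ^ (n - (j : ℕ)) = 2 * 2 ^ (n - 1 - (j : ℕ)) := by
    rw [← pow_succ']
    congr 1
    omega
  have hexp' : n - ((j : ℕ) + 1) = n - 1 - j := by omega
  rw [dyadicKernel, dyadicKernel, hexp, hexp']
  set M : ℕ := 2 ^ (n - 1 - (j : ℕ)) with hM
  have hMr : (2 : ℝ) ^ (n - 1 - (j : ℕ)) = M := by rw [hM]; push_cast; rfl
  have hM0 : (0 : ℝ) < M := by rw [hM]; positivity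
  rw [hMr] at hN ⊢
  have hw : (2 * (M : ℝ)) ^ (-(d : ℝ) / 2) * (2 * (M : ℝ)) ^ (-(d : ℝ) / 2) =
      ((2 : ℝ) ^ (j : ℕ) / 2 ^ n) ^ d := by
    rw [← Real.rpow_add (by positivity), hN, ← add_div, ← two_mul, mul_div_cancel_left₀ _ two_ne_zero,
      Real.rpow_neg (by positivity), Real.rpow_natCast, ← inv_pow]
    congr 1
    field_simp
  have hw' : ((2 : ℝ) ^ ((j : ℕ) + 1) / 2 ^ n) ^ d = ((2 : ℝ) ^ (j : ℕ) / 2 ^ n) ^ d * 2 ^ d := by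
    rw [← mul_pow, pow_succ]
    congr 1
    ring
  set w := (2 * (M : ℝ)) ^ (-(d : ℝ) / 2)
  have hterm : ∀ (k : Fin d → Fin (2 ^ (j : ℕ))) (e : Fin d → Bool),
      (w * ∏ i, dyadicHaar M (e i) (k i) (α i)) * (w * ∏ i, dyadicHaar M (e i) (k i) (β i)) =
      (w * w) * ∏ i, dyadicHaar M (e i) (k i) (α i) * dyadicHaar M (e i) (k i) (β i) := by
    intro k e
    rw [Finset.prod_mul_distrib]
    ring
  have hsplit : ∀ k : Fin d → Fin (2 ^ (j : ℕ)),
      ∑ e : {e : Fin d → Bool // e ≠ fun _ => false},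
        (w * ∏ i, dyadicHaar M (e.1 i) (k i) (α i)) * (w * ∏ i, dyadicHaar M (e.1 i) (k i) (β i)) =
      (w * w) * (∑ e : Fin d → Bool,
        ∏ i, dyadicHaar M (e i) (k i) (α i) * dyadicHaar M (e i) (k i) (β i) -
        ∏ i, dyadicHaar M false (k i) (α i) * dyadicHaar M false (k i) (β i)) := by
    intro k
    rw [Fintype.sum_eq_add_sum_subtype_ne (fun e : Fin d → Bool =>
      ∏ i, dyadicHaar M (e i) (k i) (α i) * dyadicHaar M (e i) (k i) (β i)) (fun _ => false),
      add_sub_cancel_left, Finset.mul_sum]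
    exact Finset.sum_congr rfl fun e _ => hterm k e.1
  simp only [hsplit]
  rw [← Finset.mul_sum, Finset.sum_sub_distrib,
    sum_sum_prod_eq_prod_sum_sum (fun i (κ : Fin (2 ^ (j : ℕ))) b =>
      dyadicHaar M b κ (α i) * dyadicHaar M b κ (β i))]
  have h0 : ∑ k : Fin d → Fin (2 ^ (j : ℕ)),
      ∏ i, dyadicHaar M false (k i) (α i) * dyadicHaar M false (k i) (β i) =
      ∏ i, ∑ κ : Fin (2 ^ (j : ℕ)), dyadicHaar M false κ (α i) * dyadicHaar M false κ (β i) := by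
    simp only [Finset.prod_univ_sum, Fintype.piFinset_univ]
  rw [h0]
  simp only [sum_dyadicHaar_mul (hlt _), sum_dyadicHaar_false_mul (hlt _)]
  rw [hw, hw', Finset.prod_mul_distrib, Finset.prod_const, Finset.card_univ, Fintype.card_fin]
  ring

/-- The kernels telescope: the constant vector supplies scale 0, and at scale `n` the cubes are
single points. -/
lemma sum_haarEntry_mul {d n : ℕ} (α β : Fin d → Fin (2 ^ n)) :
    ∑ t, haarEntry d n t α * haarEntry d n t β = if α = β then 1 else 0 := by
  rw [Fintype.sum_option, Fintype.sum_sigma]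
  simp only [Fintype.sum_prod_type, sum_haarEntry_mul_scale]
  rw [Fin.sum_univ_eq_sum_range (fun j => dyadicKernel α β (j + 1) - dyadicKernel α β j) n,
    Finset.sum_range_sub]
  have h0 : haarEntry d n none α * haarEntry d n none β = dyadicKernel α β 0 := by
    have : ∀ a : Fin (2 ^ n), (a : ℕ) / 2 ^ n = 0 := fun a => Nat.div_eq_of_lt a.2
    simp only [haarEntry, dyadicKernel, Nat.sub_zero, this, if_true, Finset.prod_const_one]
    rw [← Real.rpow_add (by positivity), ← add_div, ← two_mul,
      mul_div_cancel_left₀ _ two_ne_zero, Real.rpow_neg (by positivity), Real.rpow_natCast]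
    simp
  rw [h0, add_sub_cancel, dyadicKernel, div_self (by positivity), one_pow, one_mul]
  simp only [Nat.sub_self, pow_zero, Nat.div_one, Fin.val_inj]
  rw [Finset.prod_ite_zero]
  simp [funext_iff]

lemma adjoint_haarTransform_haarTransform {d n : ℕ} (v : Signal d (2 ^ n)) :
    LinearMap.adjoint (haarTransform d n) (haarTransform d n v) = v := by
  refine ext_inner_right ℂ fun x => ?_
  rw [LinearMap.adjoint_inner_left, PiLp.inner_apply, PiLp.inner_apply]
  simp only [RCLike.inner_apply, haarTransform_apply, map_sum, map_mul, Complex.conj_ofReal,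
    Finset.sum_mul_sum]
  rw [Finset.sum_comm]
  refine Finset.sum_congr rfl fun α _ => ?_
  rw [Finset.sum_comm]
  have : ∀ β, ∑ t, (haarEntry d n t α : ℂ) * x α * ((haarEntry d n t β : ℂ) *
      (starRingEnd ℂ) (v β)) = (if α = β then 1 else 0) * (x α * (starRingEnd ℂ) (v β)) := by
    intro β
    have h := congrArg (fun r : ℝ => (r : ℂ)) (sum_haarEntry_mul α β)
    simp only [Complex.ofReal_sum, Complex.ofReal_mul, apply_ite Complex.ofReal,
      Complex.ofReal_one, Complex.ofReal_zero] at h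
    rw [← h, Finset.sum_mul]
    exact Finset.sum_congr rfl fun t _ => by ring
  simp only [this]
  simp

lemma norm_haarTransform {d n : ℕ} (v : Signal d (2 ^ n)) : ‖haarTransform d n v‖ = ‖v‖ := by
  have h : inner ℂ (haarTransform d n v) (haarTransform d n v) = inner ℂ v v := by
    rw [← LinearMap.adjoint_inner_left, adjoint_haarTransform_haarTransform]
  rw [inner_self_eq_norm_sq_to_K, inner_self_eq_norm_sq_to_K] at h
  have h' : ‖haarTransform d n v‖ ^ 2 = ‖v‖ ^ 2 := by exact_mod_cast h
  exact (sq_eq_sq₀ (norm_nonneg _) (norm_nonneg _)).1 h'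

/-! ### Wavelet coefficients against total variation. -/

lemma sum_norm_dyadicHaar_fin_le {N M K : ℕ} (hM : 0 < M) (hN : N = 2 * M * K)
    (f : Fin N → ℂ) :
    ∑ κ : Fin K, ‖∑ a : Fin N, (dyadicHaar M true κ a : ℂ) * f a‖ ≤
      M * ∑ a : Fin N, ‖if h : (a : ℕ) + 1 < N then f ⟨a + 1, h⟩ - f a else 0‖ := by
  rcases Nat.eq_zero_or_pos N with h0 | h0
  · subst h0
    simp
  -- Extending `f` by its last value makes the final difference vanish, as the discrete gradient
  -- does on the last layer.
  have key := sum_norm_dyadicHaar_le hM K fun a => f ⟨min a (N - 1), by omega⟩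
  rw [← hN] at key
  have hmin : ∀ a : Fin N, min (a : ℕ) (N - 1) = a := fun a => by omega
  rw [← Fin.sum_univ_eq_sum_range
    (fun a => ‖f ⟨min (a + 1) (N - 1), by omega⟩ - f ⟨min a (N - 1), by omega⟩‖) N] at key
  refine le_trans (le_of_eq ?_) (key.trans (le_of_eq ?_))
  · refine Finset.sum_congr rfl fun κ _ => ?_
    rw [← Fin.sum_univ_eq_sum_range
      (fun a => (dyadicHaar M true κ a : ℂ) * f ⟨min a (N - 1), by omega⟩) N]
    simp only [hmin]
  · congr 1
    refine Finset.sum_congr rfl fun a _ => ?_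
    simp only [hmin]
    split_ifs with h
    · have : min ((a : ℕ) + 1) (N - 1) = a + 1 := by omega
      simp only [this]
    · have : min ((a : ℕ) + 1) (N - 1) = a := by omega
      simp only [this, Fin.eta, sub_self]

/-- The `ℓ₁` norm of the Haar coefficients at one scale and of one type, up to normalization, is
bounded by the variation in a direction in which the wavelet oscillates. -/
lemma sum_norm_prod_dyadicHaar_le {d N M K : ℕ} (hM : 0 < M) (hN : N = 2 * M * K)
    (e : Fin d → Bool) (i : Fin d) (he : e i = true) (x : Signal d N) :
    ∑ k : Fin d → Fin K,
        ‖∑ α : Fin d → Fin N, ((∏ l, dyadicHaar M (e l) (k l) (α l) : ℝ) : ℂ) * x α‖ ≤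
      M * ∑ α, ‖discreteGradient x α i‖ := by
  obtain _ | d := d
  · exact i.elim0
  have hα : ∀ {E : Type} [AddCommMonoid E] (f : (Fin (d + 1) → Fin N) → E),
      ∑ α, f α = ∑ a : Fin N, ∑ α : Fin d → Fin N, f (i.insertNth a α) := fun f => by
    rw [← (Fin.insertNthEquiv (fun _ => Fin N) i).sum_comp, Fintype.sum_prod_type]
    rfl
  rw [← (Fin.insertNthEquiv (fun _ => Fin K) i).sum_comp]
  simp only [hα, Fintype.sum_prod_type, Fin.insertNthEquiv_apply, Fin.prod_univ_succAbove _ i,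
    Fin.insertNth_apply_same, Fin.insertNth_apply_succAbove, he, discreteGradient,
    Fin.update_insertNth]
  set w : (Fin d → Fin K) → (Fin d → Fin N) → ℝ := fun k α =>
    ∏ l, dyadicHaar M (e (i.succAbove l)) (k l) (α l) with hw
  -- For each `α`, at most one position `k` in the remaining directions has a cube containing `α`,
  -- so summing over `k` costs nothing.
  have hw1 : ∀ α, ∑ k, |w k α| ≤ 1 := by
    intro α
    simp only [hw, Finset.abs_prod]
    have := Finset.prod_univ_sum (fun _ : Fin d => (univ : Finset (Fin K)))
      (fun l κ => |dyadicHaar M (e (i.succAbove l)) κ (α l)|)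
    rw [Fintype.piFinset_univ] at this
    rw [← this]
    exact Finset.prod_le_one (fun _ _ => by positivity) fun l _ => sum_abs_dyadicHaar_le _ _ _ _
  set c : Fin K → (Fin d → Fin N) → ℂ := fun κ α =>
    ∑ a : Fin N, (dyadicHaar M true κ a : ℂ) * x (i.insertNth a α) with hc
  calc _ = ∑ κ : Fin K, ∑ k : Fin d → Fin K, ‖∑ α, (w k α : ℂ) * c κ α‖ := by
        refine Finset.sum_congr rfl fun κ _ => Finset.sum_congr rfl fun k _ => ?_
        rw [Finset.sum_comm]
        congr 1
        refine Finset.sum_congr rfl fun α _ => ?_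
        rw [hc, Finset.mul_sum]
        refine Finset.sum_congr rfl fun a _ => ?_
        rw [hw]
        push_cast
        ring
    _ ≤ ∑ κ : Fin K, ∑ k : Fin d → Fin K, ∑ α, |w k α| * ‖c κ α‖ := by
        refine Finset.sum_le_sum fun κ _ => Finset.sum_le_sum fun k _ => ?_
        refine (norm_sum_le _ _).trans (le_of_eq ?_)
        simp
    _ = ∑ κ : Fin K, ∑ α, (∑ k, |w k α|) * ‖c κ α‖ := by
        refine Finset.sum_congr rfl fun κ _ => ?_
        rw [Finset.sum_comm]
        simp only [Finset.sum_mul]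
    _ ≤ ∑ κ : Fin K, ∑ α, ‖c κ α‖ := by
        refine Finset.sum_le_sum fun κ _ => Finset.sum_le_sum fun α _ => ?_
        exact mul_le_of_le_one_left (norm_nonneg _) (hw1 α)
    _ = ∑ α, ∑ κ : Fin K, ‖c κ α‖ := Finset.sum_comm
    _ ≤ ∑ α : Fin d → Fin N, M * ∑ a : Fin N, ‖if h : (a : ℕ) + 1 < N then
          x (i.insertNth ⟨a + 1, h⟩ α) - x (i.insertNth a α) else 0‖ :=
        Finset.sum_le_sum fun α _ =>
          sum_norm_dyadicHaar_fin_le hM hN fun a => x (i.insertNth a α)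
    _ = _ := by
        rw [← Finset.mul_sum, Finset.sum_comm]

lemma sum_norm_haarTransform_le {d n : ℕ} (hd : 2 ≤ d) (v : Signal d (2 ^ n)) (j : Fin n)
    (e : {e : Fin d → Bool // e ≠ fun _ => false}) :
    ∑ k, ‖haarTransform d n v (some ⟨j, k, e⟩)‖ ≤ anisotropicTV v := by
  obtain ⟨i, hi⟩ : ∃ i, e.1 i = true := by
    by_contra! h
    exact e.2 (funext fun i => by simpa using h i)
  simp only [haarTransform_apply, haarEntry]
  set M : ℕ := 2 ^ (n - 1 - (j : ℕ)) with hM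
  have hMr : (2 : ℝ) ^ (n - 1 - (j : ℕ)) = M := by rw [hM]; push_cast; rfl
  have hM1 : 1 ≤ M := Nat.one_le_two_pow
  have hM1' : (1 : ℝ) ≤ M := by exact_mod_cast hM1
  rw [hMr]
  set w := (2 * (M : ℝ)) ^ (-(d : ℝ) / 2) with hw
  have hw0 : 0 ≤ w := by positivity
  -- The place where `d ≥ 2` is essential: the exponent `-d/2 ≤ -1` absorbs the factor `M` from
  -- telescoping.
  have hwM : w * M ≤ 1 := by
    have hd' : (2 : ℝ) ≤ d := by exact_mod_cast hd
    have h1 : w ≤ (2 * (M : ℝ)) ^ (-1 : ℝ) :=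
      Real.rpow_le_rpow_of_exponent_le (by linarith) (by linarith)
    rw [Real.rpow_neg_one] at h1
    calc w * M ≤ (2 * (M : ℝ))⁻¹ * M := by gcongr
      _ ≤ 1 := by
        rw [inv_mul_le_iff₀ (by positivity)]
        linarith
  have key := sum_norm_prod_dyadicHaar_le hM1 (two_pow_eq_scale j.2) e.1 i hi v
  have hTV : ∑ α, ‖discreteGradient v α i‖ ≤ anisotropicTV v :=
    Finset.sum_le_sum fun α _ =>
      Finset.single_le_sum (f := fun l => ‖discreteGradient v α l‖)
        (fun _ _ => norm_nonneg _) (mem_univ i)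
  have hS : 0 ≤ ∑ α, ‖discreteGradient v α i‖ := by positivity
  calc _ = w * ∑ k : Fin d → Fin (2 ^ (j : ℕ)),
        ‖∑ α, ((∏ l, dyadicHaar M (e.1 l) (k l) (α l) : ℝ) : ℂ) * v α‖ := by
        rw [Finset.mul_sum]
        refine Finset.sum_congr rfl fun k _ => ?_
        have : ∑ α, ((w * ∏ l, dyadicHaar M (e.1 l) (k l) (α l) : ℝ) : ℂ) * v α =
            (w : ℂ) * ∑ α, ((∏ l, dyadicHaar M (e.1 l) (k l) (α l) : ℝ) : ℂ) * v α := by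
          rw [Finset.mul_sum]
          refine Finset.sum_congr rfl fun α _ => ?_
          rw [Complex.ofReal_mul, mul_assoc]
        rw [this, norm_mul, Complex.norm_real, Real.norm_of_nonneg hw0]
    _ ≤ w * (M * ∑ α, ‖discreteGradient v α i‖) := by gcongr
    _ = (w * M) * ∑ α, ‖discreteGradient v α i‖ := by ring
    _ ≤ 1 * ∑ α, ‖discreteGradient v α i‖ := by gcongr
    _ ≤ anisotropicTV v := by rwa [one_mul]

/-- The `ℓ₁` norm of the wavelet coefficients is bounded by the total variation, up to a factor
logarithmic in the side length. -/
lemma sum_erase_none_norm_haarTransform_le {d n : ℕ} (hd : 2 ≤ d) (v : Signal d (2 ^ n)) :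
    ∑ t ∈ univ.erase none, ‖haarTransform d n v t‖ ≤ n * 2 ^ d * anisotropicTV v := by
  have hTV : 0 ≤ anisotropicTV v := by unfold anisotropicTV; positivity
  have h1 : ∑ t ∈ univ.erase none, ‖haarTransform d n v t‖ =
      ∑ t, ‖haarTransform d n v (some t)‖ := by
    have h := Finset.sum_erase_add univ (fun t => ‖haarTransform d n v t‖) (mem_univ none)
    rw [Fintype.sum_option] at h
    linarith
  rw [h1, Fintype.sum_sigma]
  calc _ ≤ ∑ _j : Fin n, 2 ^ d * anisotropicTV v := by
        refine Finset.sum_le_sum fun j _ => ?_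
        rw [Fintype.sum_prod_type, Finset.sum_comm]
        refine (Finset.sum_le_sum fun e _ => sum_norm_haarTransform_le hd v j e).trans ?_
        rw [Finset.sum_const, nsmul_eq_mul, Finset.card_univ]
        gcongr
        have := Fintype.card_subtype_le fun e : Fin d → Bool => e ≠ fun _ => false
        rw [Fintype.card_fun, Fintype.card_bool, Fintype.card_fin] at this
        exact_mod_cast this
    _ = n * 2 ^ d * anisotropicTV v := by
        simp
        ring

/-! ### Comparison of the seminorms and conclusion. -/

lemma anisotropicTV_le_sqrt_mul_isotropicTV {d N : ℕ} (x : Signal d N) :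
    anisotropicTV x ≤ √(d : ℝ) * isotropicTV x := by
  rw [anisotropicTV, isotropicTV, Finset.mul_sum]
  refine Finset.sum_le_sum fun α _ => ?_
  rw [← Real.sqrt_mul (by positivity)]
  refine Real.le_sqrt_of_sq_le ?_
  simpa using sq_sum_le_card_mul_sum_sq (s := univ) (f := fun l => ‖discreteGradient x α l‖)

lemma natCast_le_log_two_pow_pow {d : ℕ} (hd : 2 ≤ d) (n : ℕ) :
    (n : ℝ) ≤ Real.log (((2 : ℝ) ^ n) ^ d) := by
  rw [Real.log_pow, Real.log_pow]
  have h1 := Real.log_two_gt_d9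
  -- With `d ≥ 2`, `d * log 2 ≥ 2 * log 2 > 1`.
  have hd' : (2 : ℝ) ≤ d := by exact_mod_cast hd
  have hn : (0 : ℝ) ≤ n := Nat.cast_nonneg n
  have : 1 ≤ (d : ℝ) * Real.log 2 := by nlinarith
  nlinarith

theorem mainTheorem2 (d : ℕ) (hd : 2 ≤ d) :
    ∃ C : ℝ, 0 < C ∧
      ∀ (n m s : ℕ), 1 ≤ s →
      ∀ (A : Signal d (2 ^ n) →ₗ[ℂ] EuclideanSpace ℂ (Fin m)) (δ : ℝ), δ < 1 →
        HasRIP (A ∘ₗ LinearMap.adjoint (haarTransform d n)) (2 * s) δ →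
      ∀ (ε : ℝ) (v : Signal d (2 ^ n)), ‖A v‖ ≤ ε →
        ‖v‖ ≤ (C * (anisotropicTV v / √(s : ℝ)) * Real.log (((2 : ℝ) ^ n) ^ d) + ε)
            / √(1 - δ) ∧
        ‖v‖ ≤ (C * (isotropicTV v / √((s : ℝ) / (d : ℝ))) * Real.log (((2 : ℝ) ^ n) ^ d) + ε)
            / √(1 - δ) := by
  -- The 6 comes from the stability estimate and `2 ^ d` bounds the number of wavelet types.
  refine ⟨6 * 2 ^ d, by positivity, fun n m s hs A δ hδ hA ε v hv => ?_⟩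
  have hmain := hA.norm_le hs hδ none (haarTransform d n v) (ε := ε)
    (by rwa [LinearMap.comp_apply, adjoint_haarTransform_haarTransform])
    (sum_erase_none_norm_haarTransform_le hd v)
  rw [norm_haarTransform] at hmain
  have hlog := natCast_le_log_two_pow_pow hd n
  set l := Real.log (((2 : ℝ) ^ n) ^ d)
  have hTV : 0 ≤ anisotropicTV v := by unfold anisotropicTV; positivity
  have h1 : ‖v‖ ≤ (6 * 2 ^ d * (anisotropicTV v / √(s : ℝ)) * l + ε) / √(1 - δ) := by
    refine hmain.trans ?_
    have : 6 * (n * 2 ^ d * anisotropicTV v / √(s : ℝ)) =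
        6 * 2 ^ d * (anisotropicTV v / √(s : ℝ)) * n := by ring
    rw [this]
    gcongr
  refine ⟨h1, h1.trans ?_⟩
  have hl : 0 ≤ l := (Nat.cast_nonneg n).trans hlog
  -- The Cauchy–Schwarz loss `√d` is exactly what replacing `s` by `s / d` provides.
  have h2 : anisotropicTV v / √(s : ℝ) ≤ isotropicTV v / √((s : ℝ) / (d : ℝ)) := by
    rw [Real.sqrt_div (by positivity), div_div_eq_mul_div, mul_comm (isotropicTV v)]
    gcongr
    exact anisotropicTV_le_sqrt_mul_isotropicTV v
  gcongr
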